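/- Graphs are finite, simple and have at least one vertex; $\chi(G)$ and $\omega(G)$ denote the chromatic number and the clique number of $G$. A bull is a graph obtained from a four-vertex path by adding a vertex adjacent to exactly the two middle vertices of the path, and a graph is bull-free if no induced subgraph of it is isomorphic to a bull. For an integer $t\ge 1$, let $\mathcal B_t$ be the class of all bull-free graphs $G$ such that every triangle-free induced subgraph of $G$ has chromatic number at most $t$. A polynomial $\chi$-bounding function for $\mathcal B_t$ is a function $f:\{1,2,3,\dots\}\to\{1,2,3,\dots\}$ that agrees on the positive integers with a real polynomial and satisfies $\chi(G)\le f(\omega(G))$ for every $G\in\mathcal B_t$. Theorem. For every integer $t\ge 1$, every polynomial $\chi$-bounding function for $\mathcal B_t$ (assumed to be non-constant in the case $t=1$) has degree greater than $\tfrac12\log_2 t$. -/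

import Mathlib

/-- The bull: the four-vertex path `0 - 1 - 2 - 3` together with a fifth vertex `4` adjacent to
the two middle vertices `1` and `2` of the path. -/
def bull : SimpleGraph (Fin 5) :=
  SimpleGraph.fromEdgeSet {s(0, 1), s(1, 2), s(2, 3), s(4, 1), s(4, 2)}

/-- A graph is bull-free if no induced subgraph of it is (isomorphic to) the bull. -/
def IsBullFree {V : Type} (G : SimpleGraph V) : Prop :=
  ¬ bull.IsIndContained G

/-- A class of graphs, as a predicate on graphs. Only its finite members are used. -/
abbrev GraphClass : Type 1 :=
  ∀ {V : Type}, SimpleGraph V → Prop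

/-- The class of bull-free graphs all of whose triangle-free induced subgraphs have chromatic
number at most `t`. -/
def BullFreeClass (t : ℕ) : GraphClass := fun {V} (G : SimpleGraph V) =>
  IsBullFree G ∧
    ∀ s : Set V, (G.induce s).CliqueFree 3 → (G.induce s).chromaticNumber ≤ (t : ℕ∞)

/-- `f` is a `χ`-bounding function for the class `C`: every finite graph `G` in `C` satisfies
`χ(G) ≤ f(ω(G))`. As `f` is defined on the positive integers, `G` has at least one vertex; then
its clique number is positive, and `k` is that number. -/
def IsChiBounding (C : GraphClass) (f : ℕ+ → ℕ+) : Prop :=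
  ∀ (V : Type) [Finite V] [Nonempty V] (G : SimpleGraph V), C G →
    ∀ k : ℕ+, G.cliqueNum = (k : ℕ) → G.chromaticNumber ≤ ((f k : ℕ) : ℕ∞)

/-! If `H` is triangle-free and `t`-colorable, its lexicographic powers stay in the class, their
clique numbers are at most `2 ^ k`, and a fractional clique of weight `a` in `H` yields one of
weight `a ^ k`. A bounding polynomial of degree `d` thus gives `a ^ k ≤ C * (2 ^ d) ^ k` for all
`k`, hence `a ≤ 2 ^ d` (`sum_fractionalClique_le_two_pow_natDegree`). Iterated Mycielskians supply
`H`: each step costs one colour and turns `a` into `a + 1 / a`, so `a ^ 2` grows by at least 2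
(`exists_triangleFree_fractionalClique`). With `t` colours `a ^ 2 ≥ 2 * t - 1`, which exceeds `t`
once `t ≥ 2`, so `t < 4 ^ d`. -/

namespace SimpleGraph

/-! ### Fractional cliques and fractional colourings -/

section FractionalClique

variable {V W ι : Type*}

/-- A fractional clique: a nonnegative weighting of the vertices in which every independent set
has weight at most one. -/
structure IsFractionalClique [Fintype V] (G : SimpleGraph V) (w : V → ℝ) : Prop where
  nonneg : ∀ v, 0 ≤ w v
  sum_le_one : ∀ S : Set V, G.IsIndepSet S → ∑ v, S.indicator w v ≤ 1

/-- A fractional colouring: a nonnegative weighting `x` of the independent sets `I i` in which the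
sets containing any given vertex have total weight one. -/
structure IsFractionalColoring [Fintype ι] (G : SimpleGraph V) (I : ι → Set V) (x : ι → ℝ) :
    Prop where
  nonneg : ∀ i, 0 ≤ x i
  isIndepSet : ∀ i, G.IsIndepSet (I i)
  sum_eq_one : ∀ v, ∑ i, (I i).indicator (fun _ => x i) v = 1

theorem IsIndepSet.not_adj {G : SimpleGraph V} {S : Set V} (hS : G.IsIndepSet S) {u v : V}
    (hu : u ∈ S) (hv : v ∈ S) : ¬ G.Adj u v :=
  fun h => hS hu hv h.ne h

theorem isIndepSet_of_not_adj {G : SimpleGraph V} {S : Set V}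
    (h : ∀ u ∈ S, ∀ v ∈ S, ¬ G.Adj u v) : G.IsIndepSet S :=
  fun u hu v hv _ => h u hu v hv

theorem cliqueFree_three_iff {G : SimpleGraph V} :
    G.CliqueFree 3 ↔ ∀ a b c, G.Adj a b → G.Adj a c → ¬ G.Adj b c := by
  classical
  constructor
  · intro h a b c hab hac hbc
    exact h {a, b, c} (is3Clique_triple_iff.2 ⟨hab, hac, hbc⟩)
  · intro h s hs
    obtain ⟨a, b, c, hab, hac, hbc, -⟩ := is3Clique_iff.1 hs
    exact h a b c hab hac hbc

theorem IsFractionalClique.sum_le_of_colorable [Fintype V] {G : SimpleGraph V} {w : V → ℝ}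
    (hw : G.IsFractionalClique w) {n : ℕ} (h : G.Colorable n) : ∑ v, w v ≤ n := by
  obtain ⟨C⟩ := h
  calc ∑ v, w v = ∑ v, ∑ c, (C.colorClass c).indicator w v := by
        refine Finset.sum_congr rfl fun v _ => ?_
        rw [Finset.sum_eq_single (C v)]
        · rw [Set.indicator_of_mem (C.mem_colorClass v)]
        · intro c _ hc
          exact Set.indicator_of_notMem (fun h => hc h.symm) _
        · simp
    _ = ∑ c, ∑ v, (C.colorClass c).indicator w v := Finset.sum_comm
    _ ≤ ∑ _c : Fin n, (1 : ℝ) :=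
        Finset.sum_le_sum fun c _ => hw.sum_le_one _ (C.isIndepSet_colorClass c)
    _ = n := by simp

/-- If `A` is independent and no vertex of `B` has a neighbour in `A`, then a fractional colouring
bounds the weight of `B` outside `A` by the weight that `A` leaves over. -/
theorem IsFractionalClique.sum_add_sum_le [Fintype V] [Fintype ι] {G : SimpleGraph V} {w : V → ℝ}
    (hw : G.IsFractionalClique w) {I : ι → Set V} {x : ι → ℝ} (hx : G.IsFractionalColoring I x)
    {A B : Set V} (hA : G.IsIndepSet A) (hAB : ∀ u ∈ A, ∀ v ∈ B, ¬ G.Adj u v) :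
    (∑ i, x i) * ∑ v, A.indicator w v + ∑ v, (B \ A).indicator w v ≤ ∑ i, x i := by
  classical
  -- `A ∪ (I i ∩ (B \ A))` is independent; averaging over `i` with weights `x i` counts each vertex
  -- of `B \ A` exactly once.
  have key (i : ι) : x i * ∑ v, A.indicator w v + x i * ∑ v, (I i ∩ (B \ A)).indicator w v
      ≤ x i := by
    have hS : G.IsIndepSet (A ∪ I i ∩ (B \ A)) := by
      refine isIndepSet_of_not_adj ?_
      rintro u (hu | hu) v (hv | hv) huv
      · exact hA.not_adj hu hv huv
      · exact hAB u hu v hv.2.1 huv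
      · exact hAB v hv u hu.2.1 huv.symm
      · exact (hx.isIndepSet i).not_adj hu.1 hv.1 huv
    have h := hw.sum_le_one _ hS
    rw [Set.indicator_union_of_disjoint
      (Set.disjoint_left.2 fun v hv hv' => hv'.2.2 hv), Finset.sum_add_distrib] at h
    rw [← mul_add]
    exact mul_le_of_le_one_right (hx.nonneg i) h
  have hB : ∑ i, x i * ∑ v, (I i ∩ (B \ A)).indicator w v = ∑ v, (B \ A).indicator w v := by
    simp_rw [Finset.mul_sum]
    rw [Finset.sum_comm]
    refine Finset.sum_congr rfl fun v _ => ?_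
    calc ∑ i, x i * (I i ∩ (B \ A)).indicator w v
        = ∑ i, (I i).indicator (fun _ => x i) v * (B \ A).indicator w v := by
          refine Finset.sum_congr rfl fun i _ => ?_
          by_cases h1 : v ∈ I i <;> by_cases h2 : v ∈ B \ A <;>
            simp only [Set.indicator, Set.mem_inter_iff, h1, h2] <;> simp
      _ = (B \ A).indicator w v := by rw [← Finset.sum_mul, hx.sum_eq_one, one_mul]
  calc _ = ∑ i, (x i * ∑ v, A.indicator w v + x i * ∑ v, (I i ∩ (B \ A)).indicator w v) := by
        rw [Finset.sum_add_distrib, hB, Finset.sum_mul]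
    _ ≤ _ := Finset.sum_le_sum fun i _ => key i

end FractionalClique

/-! ### The Mycielskian and its fractional chromatic number -/

section Mycielskian

variable {V ι : Type*}

/-- The Mycielskian of `G`: a copy `inl v` and a twin `inr v` of every vertex `v`, the twin being
adjacent to the copies of the neighbours of `v`, and an apex `none` adjacent to all the twins. -/
def mycielskian (G : SimpleGraph V) : SimpleGraph (Option (V ⊕ V)) where
  Adj
    | some (.inl u), some (.inl v) => G.Adj u v
    | some (.inl u), some (.inr v) => G.Adj u v
    | some (.inr u), some (.inl v) => G.Adj u v
    | some (.inr _), none => True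
    | none, some (.inr _) => True
    | _, _ => False
  symm := by
    constructor
    rintro (_ | u | u) (_ | v | v) h <;> first | exact h | exact G.adj_symm h
  loopless := by
    constructor
    rintro (_ | u | u) h
    · exact h
    · exact G.irrefl h
    · exact h

variable {G : SimpleGraph V}

theorem mycielskian_cliqueFree_three (h : G.CliqueFree 3) : G.mycielskian.CliqueFree 3 := by
  rw [cliqueFree_three_iff] at h ⊢
  rintro (_ | a | a) (_ | b | b) (_ | c | c) hab hac hbc <;>
    first | exact hab | exact hac | exact hbc | exact h a b c hab hac hbc

theorem mycielskian_colorable {n : ℕ} (h : G.Colorable n) : G.mycielskian.Colorable (n + 1) := by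
  obtain ⟨C⟩ := h
  let D : G.mycielskian.Coloring (Option (Fin n)) := Coloring.mk
    (fun v => match v with
      | none => none
      | some (.inl v) => some (C v)
      | some (.inr v) => some (C v)) (by
    rintro (_ | a | a) (_ | b | b) h
    all_goals first
      | exact h.elim
      | exact fun e => C.valid h (Option.some_injective _ e)
      | simp)
  simpa using D.colorable

/-- The optimal fractional clique of the Mycielskian, where `a` is the total weight of `w`. -/
noncomputable def mycielskianWeight (w : V → ℝ) (a : ℝ) : Option (V ⊕ V) → ℝ
  | none => 1 / a
  | some (.inl v) => (1 - 1 / a) * w v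
  | some (.inr v) => 1 / a * w v

theorem sum_mycielskianWeight [Fintype V] {w : V → ℝ} {a : ℝ}
    (hwa : ∑ v, w v = a) : ∑ v, mycielskianWeight w a v = a + 1 / a := by
  simp only [Fintype.sum_option, Fintype.sum_sum_type, mycielskianWeight, ← Finset.mul_sum, hwa]
  ring

/-- An independent set containing the apex has no twins, so it weighs at most `1 / a + (1 - 1 / a)`.
Otherwise, with `A` its copies and `B` its twins, the bound needed is `(a - 1) * w(A) + w(B) ≤ a`,
which `sum_add_sum_le` gives because the fractional colouring has total `a`. -/
theorem IsFractionalClique.mycielskian [Fintype V] [Fintype ι] {w : V → ℝ}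
    (hw : G.IsFractionalClique w) {I : ι → Set V} {x : ι → ℝ} (hx : G.IsFractionalColoring I x)
    {a : ℝ} (ha : 1 ≤ a) (hxa : ∑ i, x i = a) :
    G.mycielskian.IsFractionalClique (mycielskianWeight w a) := by
  have h0 : 0 < a := by linarith
  have hinv : 0 ≤ 1 / a := by positivity
  have hinv' : 0 ≤ 1 - 1 / a := by
    rw [sub_nonneg, div_le_one h0]; exact ha
  refine ⟨?_, fun S hS => ?_⟩
  · rintro (_ | v | v)
    · exact hinv
    · exact mul_nonneg hinv' (hw.nonneg v)
    · exact mul_nonneg hinv (hw.nonneg v)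
  set A : Set V := {v | some (.inl v) ∈ S} with hA
  set B : Set V := {v | some (.inr v) ∈ S} with hB
  have hAi : G.IsIndepSet A := isIndepSet_of_not_adj fun u hu v hv huv =>
    hS.not_adj (u := some (.inl u)) (v := some (.inl v)) hu hv huv
  have hAB : ∀ u ∈ A, ∀ v ∈ B, ¬ G.Adj u v := fun u hu v hv huv =>
    hS.not_adj (u := some (.inl u)) (v := some (.inr v)) hu hv huv
  have hsumA : ∑ v, S.indicator (mycielskianWeight w a) (some (.inl v))
      = (1 - 1 / a) * ∑ v, A.indicator w v := by
    rw [Finset.mul_sum]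
    refine Finset.sum_congr rfl fun v _ => ?_
    by_cases h : v ∈ A
    · rw [Set.indicator_of_mem h, Set.indicator_of_mem (show some (Sum.inl v) ∈ S from h)]
      rfl
    · rw [Set.indicator_of_notMem h, Set.indicator_of_notMem (show some (Sum.inl v) ∉ S from h),
        mul_zero]
  have hsumB : ∑ v, S.indicator (mycielskianWeight w a) (some (.inr v))
      = 1 / a * ∑ v, B.indicator w v := by
    rw [Finset.mul_sum]
    refine Finset.sum_congr rfl fun v _ => ?_
    by_cases h : v ∈ B
    · rw [Set.indicator_of_mem h, Set.indicator_of_mem (show some (Sum.inr v) ∈ S from h)]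
      rfl
    · rw [Set.indicator_of_notMem h, Set.indicator_of_notMem (show some (Sum.inr v) ∉ S from h),
        mul_zero]
  rw [Fintype.sum_option, Fintype.sum_sum_type, hsumA, hsumB]
  by_cases hz : (none : Option (V ⊕ V)) ∈ S
  · have hB0 : ∑ v, B.indicator w v = 0 := Finset.sum_eq_zero fun v _ =>
      Set.indicator_of_notMem (fun hv : v ∈ B =>
        hS.not_adj (u := none) (v := some (.inr v)) hz hv trivial) _
    have := mul_le_of_le_one_right hinv' (hw.sum_le_one A hAi)
    rw [Set.indicator_of_mem hz, hB0]
    simp only [mycielskianWeight]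
    linarith
  · have h1 := hw.sum_add_sum_le hx hAi hAB
    have h2 : ∑ v, B.indicator w v ≤ ∑ v, A.indicator w v + ∑ v, (B \ A).indicator w v := by
      rw [← Finset.sum_add_distrib]
      refine Finset.sum_le_sum fun v _ => ?_
      have := hw.nonneg v
      by_cases h1 : v ∈ A <;> by_cases h2 : v ∈ B <;>
        simp only [Set.indicator, Set.mem_sdiff, h1, h2] <;> simp [this]
    rw [hxa] at h1
    rw [Set.indicator_of_notMem hz, zero_add]
    have h3 : (a - 1) * ∑ v, A.indicator w v + ∑ v, B.indicator w v ≤ a := by linarith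
    calc (1 - 1 / a) * ∑ v, A.indicator w v + 1 / a * ∑ v, B.indicator w v
        = ((a - 1) * ∑ v, A.indicator w v + ∑ v, B.indicator w v) / a := by field_simp
      _ ≤ 1 := (div_le_one h0).2 h3

/-- The independent sets of the optimal fractional colouring of the Mycielskian. -/
def mycielskianSet (I : ι → Set V) : Option (ι ⊕ ι) → Set (Option (V ⊕ V))
  | none => {u | ∃ v, u = some (.inr v)}
  | some (.inl i) => {u | ∃ v ∈ I i, u = some (.inl v) ∨ u = some (.inr v)}
  | some (.inr i) => {u | u = none ∨ ∃ v ∈ I i, u = some (.inl v)}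

/-- Copies and twins are each covered with weight `(1 - 1 / a) + 1 / a`, and the apex with weight
`(∑ i, x i) / a = 1`. -/
theorem IsFractionalColoring.mycielskian [Fintype ι] {I : ι → Set V} {x : ι → ℝ}
    (hx : G.IsFractionalColoring I x) {a : ℝ} (ha : 1 ≤ a) (hxa : ∑ i, x i = a) :
    G.mycielskian.IsFractionalColoring (mycielskianSet I) (mycielskianWeight x a) := by
  classical
  have h0 : 0 < a := by linarith
  have hinv : 0 ≤ 1 / a := by positivity
  have hinv' : 0 ≤ 1 - 1 / a := by
    rw [sub_nonneg, div_le_one h0]; exact ha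
  refine ⟨?_, ?_, ?_⟩
  · rintro (_ | v | v)
    · exact hinv
    · exact mul_nonneg hinv' (hx.nonneg v)
    · exact mul_nonneg hinv (hx.nonneg v)
  · rintro (_ | i | i) <;> refine isIndepSet_of_not_adj ?_
    · rintro _ ⟨u, rfl⟩ _ ⟨v, rfl⟩ h
      exact h
    · rintro _ ⟨u, hu, rfl | rfl⟩ _ ⟨v, hv, rfl | rfl⟩ h
      all_goals first
        | exact (hx.isIndepSet i).not_adj hu hv h
        | exact h
    · rintro _ (rfl | ⟨u, hu, rfl⟩) _ (rfl | ⟨v, hv, rfl⟩) h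
      all_goals first
        | exact (hx.isIndepSet i).not_adj hu hv h
        | exact h
  · have hcover (c : ℝ) (v : V) : ∑ i, (if v ∈ I i then c * x i else 0) = c := by
      have := hx.sum_eq_one v
      simp only [Set.indicator_apply] at this
      calc ∑ i, (if v ∈ I i then c * x i else 0) = c * ∑ i, (if v ∈ I i then x i else 0) := by
            simp only [Finset.mul_sum, mul_ite, mul_zero]
        _ = c := by rw [this, mul_one]
    rintro (_ | v | v) <;>
      simp [Fintype.sum_option, Fintype.sum_sum_type, Set.indicator_apply, mycielskianSet,
        mycielskianWeight] <;> simp only [← one_div]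
    · rw [← Finset.mul_sum, hxa, one_div, inv_mul_cancel₀ h0.ne']
    · rw [hcover, hcover]; ring
    · rw [hcover]; ring

/-- There are triangle-free `(n + 1)`-colorable graphs whose fractional chromatic number is at
least `√(2n + 1)`. -/
theorem exists_triangleFree_fractionalClique (n : ℕ) :
    ∃ (V : Type) (_ : Fintype V) (_ : Nonempty V) (G : SimpleGraph V) (w : V → ℝ) (a : ℝ),
      G.CliqueFree 3 ∧ G.Colorable (n + 1) ∧ G.IsFractionalClique w ∧ ∑ v, w v = a ∧
        0 ≤ a ∧ 2 * (n : ℝ) + 1 ≤ a ^ 2 := by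
  -- The induction must also carry a fractional colouring of the same total `a`, since the next
  -- fractional clique depends on it.
  suffices h : ∃ (V : Type) (_ : Fintype V) (_ : Nonempty V) (G : SimpleGraph V) (w : V → ℝ)
      (a : ℝ) (ι : Type) (_ : Fintype ι) (I : ι → Set V) (x : ι → ℝ),
      G.CliqueFree 3 ∧ G.Colorable (n + 1) ∧ G.IsFractionalClique w ∧ ∑ v, w v = a ∧
        G.IsFractionalColoring I x ∧ ∑ i, x i = a ∧ 1 ≤ a ∧ 2 * (n : ℝ) + 1 ≤ a ^ 2 by
    obtain ⟨V, i1, i2, G, w, a, ι, i3, I, x, h1, h2, h3, h4, -, -, h5, h6⟩ := h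
    exact ⟨V, i1, i2, G, w, a, h1, h2, h3, h4, by linarith, h6⟩
  induction n with
  | zero =>
    refine ⟨Unit, inferInstance, inferInstance, ⊥, fun _ => 1, 1, Unit, inferInstance,
      fun _ => Set.univ, fun _ => 1, ?_, ?_, ⟨?_, ?_⟩, ?_, ⟨?_, ?_, ?_⟩, ?_, ?_, ?_⟩
    · exact cliqueFree_three_iff.2 fun _ _ _ h => h.elim
    · exact ⟨Coloring.mk (fun _ => 0) fun h => h.elim⟩
    · simp
    · intro S _
      simpa using Set.indicator_le_self' (s := S) (f := fun _ : Unit => (1 : ℝ))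
        (fun _ _ => zero_le_one) ()
    · simp
    · simp
    · exact fun _ => isIndepSet_of_not_adj fun _ _ _ _ h => h
    · simp
    · simp
    · simp
    · simp
  | succ n ih =>
    obtain ⟨V, _, _, G, w, a, ι, _, I, x, h1, h2, h3, h4, h5, h6, h7, h8⟩ := ih
    have h0 : 0 < a := by linarith
    have hinv : 0 ≤ 1 / a := by positivity
    refine ⟨Option (V ⊕ V), inferInstance, inferInstance, G.mycielskian, mycielskianWeight w a,
      a + 1 / a, Option (ι ⊕ ι), inferInstance, mycielskianSet I, mycielskianWeight x a,
      mycielskian_cliqueFree_three h1, mycielskian_colorable h2, h3.mycielskian h5 h7 h6,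
      sum_mycielskianWeight h4, h5.mycielskian h7 h6, sum_mycielskianWeight h6,
      by linarith, ?_⟩
    have : (a + 1 / a) ^ 2 = a ^ 2 + 2 + (1 / a) ^ 2 := by field_simp; ring
    rw [this]
    push_cast
    nlinarith [sq_nonneg (1 / a)]

end Mycielskian

/-! ### Lexicographic products -/

section Lex

variable {V W : Type*}

/-- The lexicographic product, in which every vertex of `H` is replaced by a copy of `G`. -/
def lex (H : SimpleGraph V) (G : SimpleGraph W) : SimpleGraph (V × W) where
  Adj p q := H.Adj p.1 q.1 ∨ p.1 = q.1 ∧ G.Adj p.2 q.2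
  symm := ⟨fun _ _ h => h.imp H.adj_symm fun h => ⟨h.1.symm, G.adj_symm h.2⟩⟩
  loopless := ⟨fun _ h => h.elim H.irrefl fun h => G.irrefl h.2⟩

variable {H : SimpleGraph V} {G : SimpleGraph W}

theorem lex_adj {p q : V × W} :
    (H.lex G).Adj p q ↔ H.Adj p.1 q.1 ∨ p.1 = q.1 ∧ G.Adj p.2 q.2 := Iff.rfl

/-- An independent set projects to an independent set of `H`, and its fibres are independent in `G`.
-/
theorem IsFractionalClique.lex [Fintype V] [Fintype W] {w : V → ℝ} {w' : W → ℝ}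
    (hw : H.IsFractionalClique w) (hw' : G.IsFractionalClique w') :
    (H.lex G).IsFractionalClique fun p => w p.1 * w' p.2 := by
  refine ⟨fun p => mul_nonneg (hw.nonneg _) (hw'.nonneg _), fun S hS => ?_⟩
  have hP : H.IsIndepSet {v | ∃ y, (v, y) ∈ S} := isIndepSet_of_not_adj fun u ⟨y, hu⟩ v ⟨z, hv⟩ h =>
    hS.not_adj hu hv (Or.inl h)
  refine le_trans ?_ (hw.sum_le_one _ hP)
  rw [Fintype.sum_prod_type]
  refine Finset.sum_le_sum fun v _ => ?_
  by_cases hv : v ∈ {v | ∃ y, (v, y) ∈ S}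
  · rw [Set.indicator_of_mem hv]
    have hi : G.IsIndepSet {y | (v, y) ∈ S} := isIndepSet_of_not_adj fun y hy z hz h =>
      hS.not_adj (u := (v, y)) (v := (v, z)) hy hz (Or.inr ⟨rfl, h⟩)
    calc ∑ y, S.indicator (fun p => w p.1 * w' p.2) (v, y)
        = w v * ∑ y, {y | (v, y) ∈ S}.indicator w' y := by
          classical
          rw [Finset.mul_sum]
          refine Finset.sum_congr rfl fun y _ => ?_
          simp only [Set.indicator_apply, Set.mem_ofPred_eq]
          split_ifs <;> simp
      _ ≤ w v := mul_le_of_le_one_right (hw.nonneg v) (hw'.sum_le_one _ hi)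
  · rw [Set.indicator_of_notMem hv]
    exact (Finset.sum_eq_zero fun y _ => Set.indicator_of_notMem (fun h => hv ⟨y, h⟩) _).le

theorem card_le_of_isClique_lex {m n : ℕ} (hH : ∀ s : Finset V, H.IsClique s → s.card ≤ m)
    (hG : ∀ s : Finset W, G.IsClique s → s.card ≤ n) (s : Finset (V × W))
    (hs : (H.lex G).IsClique s) : s.card ≤ m * n := by
  classical
  have hfib : s.card ≤ n * (s.image Prod.fst).card := by
    refine Finset.card_le_mul_card_image s n fun v _ => ?_
    have hinj : Set.InjOn Prod.snd ((s.filter fun p => p.1 = v : Finset (V × W)) : Set (V × W)) := by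
      intro p hp q hq h
      simp only [Finset.coe_filter, Set.mem_ofPred_eq] at hp hq
      exact Prod.ext (hp.2.trans hq.2.symm) h
    rw [← Finset.card_image_of_injOn hinj]
    refine hG _ fun y hy z hz hyz => ?_
    simp only [Finset.coe_image, Finset.coe_filter, Set.mem_image, Set.mem_ofPred_eq] at hy hz
    obtain ⟨p, ⟨hp, rfl⟩, rfl⟩ := hy
    obtain ⟨q, ⟨hq, hqp⟩, rfl⟩ := hz
    rcases hs hp hq (fun h => hyz (congrArg _ h)) with h | h
    · exact (h.ne hqp.symm).elim
    · exact h.2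
  have himg : (s.image Prod.fst).card ≤ m := by
    refine hH _ fun u hu v hv huv => ?_
    simp only [Finset.coe_image, Set.mem_image] at hu hv
    obtain ⟨p, hp, rfl⟩ := hu
    obtain ⟨q, hq, rfl⟩ := hv
    rcases hs hp hq (fun h => huv (congrArg _ h)) with h | h
    · exact h
    · exact (huv h.1).elim
  calc s.card ≤ n * (s.image Prod.fst).card := hfib
    _ ≤ n * m := Nat.mul_le_mul_left n himg
    _ = m * n := mul_comm _ _

/-- If `H` and all triangle-free induced subgraphs of `G` are `t`-colorable, then so are the
triangle-free induced subgraphs of the lexicographic product. -/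
theorem induce_lex_colorable {t : ℕ} (hH : H.Colorable t)
    (hG : ∀ s : Set W, (G.induce s).CliqueFree 3 → (G.induce s).Colorable t) (s : Set (V × W))
    (hs : ((H.lex G).induce s).CliqueFree 3) : ((H.lex G).induce s).Colorable t := by
  classical
  obtain ⟨C⟩ := hH
  rw [cliqueFree_three_iff] at hs
  have hfib (v : V) : (G.induce {y | (v, y) ∈ s}).Colorable t := by
    refine hG _ (cliqueFree_three_iff.2 fun a b c hab hac hbc => ?_)
    exact hs ⟨(v, a), a.2⟩ ⟨(v, b), b.2⟩ ⟨(v, c), c.2⟩ (Or.inr ⟨rfl, hab⟩) (Or.inr ⟨rfl, hac⟩)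
      (Or.inr ⟨rfl, hbc⟩)
  let D (v : V) : (G.induce {y | (v, y) ∈ s}).Coloring (Fin t) := (hfib v).some
  -- A fibre with a nonempty neighbouring fibre has no edges, as an edge would complete a triangle,
  -- so one colour from `C` serves it. Any other fibre has no edges leaving it and keeps its own
  -- colouring.
  refine ⟨Coloring.mk (fun p => if ∃ q ∈ s, H.Adj p.1.1 q.1 then C p.1.1
    else D p.1.1 ⟨p.1.2, p.2⟩) ?_⟩
  rintro ⟨⟨u, y⟩, hp⟩ ⟨⟨v, z⟩, hq⟩ h
  rcases h with h | ⟨h1, h2⟩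
  · have h : H.Adj u v := h
    rw [if_pos ⟨_, hq, h⟩, if_pos ⟨_, hp, h.symm⟩]
    exact C.valid h
  · obtain rfl : u = v := h1
    have hn : ¬ ∃ q ∈ s, H.Adj u q.1 := by
      rintro ⟨q, hqs, hadj⟩
      exact hs ⟨(u, y), hp⟩ ⟨(u, z), hq⟩ ⟨q, hqs⟩ (Or.inr ⟨rfl, h2⟩) (Or.inl hadj) (Or.inl hadj)
    rw [if_neg hn, if_neg hn]
    exact (D u).valid (v := ⟨y, hp⟩) (w := ⟨z, hq⟩) h2

end Lex

end SimpleGraph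

/-! ### Bull-freeness and lexicographic powers -/

open SimpleGraph

/-- The bull is prime: a nonconstant map whose fibres are homogeneous sets is injective on its
triangle. -/
theorem bull_fibres {V : Type*} (c : Fin 5 → V)
    (hc : ∀ i j k, c i = c j → c k ≠ c i → (bull.Adj k i ↔ bull.Adj k j)) :
    (c 1 ≠ c 2 ∧ c 1 ≠ c 4 ∧ c 2 ≠ c 4) ∨ ∀ i j, c i = c j := by
  have h01 : bull.Adj 0 1 := by simp [bull]
  have h02 : ¬ bull.Adj 0 2 := by simp [bull]
  have h04 : ¬ bull.Adj 0 4 := by simp [bull]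
  have h32 : bull.Adj 3 2 := by simp [bull]
  have h31 : ¬ bull.Adj 3 1 := by simp [bull]
  have h34 : ¬ bull.Adj 3 4 := by simp [bull]
  have h41 : bull.Adj 4 1 := by simp [bull]
  have h40 : ¬ bull.Adj 4 0 := by simp [bull]
  have h42 : bull.Adj 4 2 := by simp [bull]
  have h43 : ¬ bull.Adj 4 3 := by simp [bull]
  have h21 : bull.Adj 2 1 := by simp [bull]
  have h20 : ¬ bull.Adj 2 0 := by simp [bull]
  have h12 : bull.Adj 1 2 := by simp [bull]
  have h13 : ¬ bull.Adj 1 3 := by simp [bull]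
  -- A vertex that distinguishes two members of a fibre belongs to that fibre, so an equality
  -- between triangle vertices spreads to the whole bull.
  have key (i j k) (hij : c i = c j) (h1 : bull.Adj k i) (h2 : ¬ bull.Adj k j) : c k = c i := by
    by_contra h
    exact h2 ((hc i j k hij h).1 h1)
  have all (h0 : c 0 = c 1) (h2 : c 2 = c 1) (h3 : c 3 = c 1) (h4 : c 4 = c 1) (i j) :
      c i = c j := by
    have h (i) : c i = c 1 := by fin_cases i <;> first | rfl | assumption
    rw [h i, h j]
  by_cases e12 : c 1 = c 2
  · have e0 := key 1 2 0 e12 h01 h02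
    have e3 := (key 2 1 3 e12.symm h32 h31).trans e12.symm
    exact Or.inr (all e0 e12.symm e3 (key 1 0 4 e0.symm h41 h40))
  by_cases e14 : c 1 = c 4
  · have e0 := key 1 4 0 e14 h01 h04
    exact absurd (key 1 0 2 e0.symm h21 h20).symm e12
  by_cases e24 : c 2 = c 4
  · have e3 := key 2 4 3 e24 h32 h34
    exact absurd (key 2 3 1 e3.symm h12 h13) e12
  exact Or.inl ⟨e12, e14, e24⟩

/-- By `bull_fibres`, an induced bull either projects its triangle onto a triangle of `H` or lies
inside a single copy of `G`. -/
theorem IsBullFree.lex {V W : Type} {H : SimpleGraph V} {G : SimpleGraph W}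
    (hH : H.CliqueFree 3) (hG : IsBullFree G) : IsBullFree (H.lex G) := by
  rintro ⟨φ⟩
  have adj (i j) : bull.Adj i j ↔ H.Adj (φ i).1 (φ j).1 ∨ (φ i).1 = (φ j).1 ∧
      G.Adj (φ i).2 (φ j).2 := by
    rw [← φ.map_adj_iff, lex_adj]
  rcases bull_fibres (fun i => (φ i).1) (fun i j k hij hki => by
    have hkj : (φ k).1 ≠ (φ j).1 := hij ▸ hki
    rw [adj, adj, ← hij]
    simp [hki]) with ⟨h12, h14, h24⟩ | hall
  · have adj' (i j) (h : (φ i).1 ≠ (φ j).1) (hb : bull.Adj i j) : H.Adj (φ i).1 (φ j).1 :=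
      ((adj i j).1 hb).resolve_right fun e => h e.1
    exact cliqueFree_three_iff.1 hH _ _ _ (adj' 1 2 h12 (by simp [bull]))
      (adj' 1 4 h14 (by simp [bull])) (adj' 2 4 h24 (by simp [bull]))
  · refine hG ⟨⟨⟨fun i => (φ i).2, fun i j h => φ.injective (Prod.ext (hall i j) h)⟩, ?_⟩⟩
    intro i j
    have hij : (φ i).1 = (φ j).1 := hall i j
    rw [adj]
    simp only [hij, H.irrefl, false_or, true_and]
    rfl

/-- The lexicographic powers of a triangle-free `t`-colorable graph lie in `BullFreeClass t`. -/
theorem exists_lex_power {V : Type} [Fintype V] [Nonempty V] {t : ℕ} (ht : 1 ≤ t)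
    {H : SimpleGraph V} (hH : H.CliqueFree 3) (hcol : H.Colorable t) {w : V → ℝ}
    (hw : H.IsFractionalClique w) (k : ℕ) :
    ∃ (W : Type) (_ : Fintype W) (_ : Nonempty W) (G : SimpleGraph W) (w' : W → ℝ),
      BullFreeClass t G ∧ (∀ s : Finset W, G.IsClique s → s.card ≤ 2 ^ k) ∧
        G.IsFractionalClique w' ∧ ∑ y, w' y = (∑ v, w v) ^ k := by
  have hclq (s : Finset V) (hs : H.IsClique s) : s.card ≤ 2 := by
    by_contra h
    exact hH.mono (show 3 ≤ s.card by omega) s ⟨hs, rfl⟩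
  induction k with
  | zero =>
    refine ⟨Unit, inferInstance, inferInstance, ⊥, fun _ => 1, ⟨?_, ?_⟩, ?_, ⟨?_, ?_⟩, ?_⟩
    · rintro ⟨φ⟩
      exact absurd (φ.injective (a₁ := 0) (a₂ := 1) rfl) (by decide)
    · intro s _
      rw [chromaticNumber_le_iff_colorable]
      exact ⟨Coloring.mk (fun _ => ⟨0, ht⟩) fun h => h.elim⟩
    · intro s _
      simpa using s.card_le_univ
    · simp
    · intro S _
      simpa using Set.indicator_le_self' (s := S) (f := fun _ : Unit => (1 : ℝ))
        (fun _ _ => zero_le_one) ()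
    · simp
  | succ k ih =>
    obtain ⟨W, _, _, G, w', ⟨hb, hc⟩, hcl, hw', hsum⟩ := ih
    refine ⟨V × W, inferInstance, inferInstance, H.lex G, fun p => w p.1 * w' p.2,
      ⟨hb.lex hH, fun s hs => ?_⟩, fun s hs => ?_, hw.lex hw', ?_⟩
    · rw [chromaticNumber_le_iff_colorable]
      exact induce_lex_colorable hcol
        (fun s hs => chromaticNumber_le_iff_colorable.1 (hc s hs)) s hs
    · rw [pow_succ']
      exact card_le_of_isClique_lex hclq hcl s hs
    · rw [Fintype.sum_prod_type, pow_succ', ← hsum, Finset.sum_mul_sum]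

/-! ### Growth of the bounding polynomial -/

theorem Polynomial.eval_le_mul_pow_natDegree (p : Polynomial ℝ) {x : ℝ} (hx : 1 ≤ x) :
    p.eval x ≤ (∑ i ∈ Finset.range (p.natDegree + 1), |p.coeff i|) * x ^ p.natDegree := by
  rw [Polynomial.eval_eq_sum_range, Finset.sum_mul]
  refine Finset.sum_le_sum fun i hi => ?_
  have hi : i ≤ p.natDegree := Nat.lt_succ_iff.1 (Finset.mem_range.1 hi)
  exact mul_le_mul (le_abs_self _) (pow_le_pow_right₀ hx hi) (by positivity) (abs_nonneg _)

theorem le_of_forall_pow_le_mul_pow {a b C : ℝ} (hb : 0 < b)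
    (h : ∀ k : ℕ, a ^ k ≤ C * b ^ k) : a ≤ b := by
  by_contra! hab
  obtain ⟨k, hk⟩ := pow_unbounded_of_one_lt C ((one_lt_div hb).2 hab)
  rw [div_pow, lt_div_iff₀ (by positivity)] at hk
  exact absurd (h k) (not_le.2 hk)

/-- A polynomial `χ`-bounding function of `BullFreeClass t` has degree at least `log₂` of the
fractional chromatic number of any triangle-free `t`-colorable graph. -/
theorem sum_fractionalClique_le_two_pow_natDegree {t : ℕ} (ht : 1 ≤ t) {f : ℕ+ → ℕ+}
    (hf : IsChiBounding (BullFreeClass t) f) {p : Polynomial ℝ}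
    (hp : ∀ n : ℕ+, ((f n : ℕ) : ℝ) = p.eval ((n : ℕ) : ℝ)) {V : Type} [Fintype V] [Nonempty V]
    {H : SimpleGraph V} (hH : H.CliqueFree 3) (hcol : H.Colorable t) {w : V → ℝ}
    (hw : H.IsFractionalClique w) : ∑ v, w v ≤ 2 ^ p.natDegree := by
  refine le_of_forall_pow_le_mul_pow
    (C := ∑ i ∈ Finset.range (p.natDegree + 1), |p.coeff i|) (by positivity) fun k => ?_
  obtain ⟨W, _, _, G, w', hG, hclq, hw', hsum⟩ := exists_lex_power ht hH hcol hw k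
  have hpos : 0 < G.cliqueNum := by
    have y : W := Classical.arbitrary W
    have : G.IsClique (({y} : Finset W) : Set W) := by simp
    exact lt_of_lt_of_le (by simp) this.card_le_cliqueNum
  have hle : G.cliqueNum ≤ 2 ^ k := by
    obtain ⟨s, hs⟩ := G.exists_isNClique_cliqueNum
    exact hs.card_eq ▸ hclq s hs.isClique
  have hχ := chromaticNumber_le_iff_colorable.1 (hf W G hG ⟨G.cliqueNum, hpos⟩ rfl)
  have h1 := hw'.sum_le_of_colorable hχ
  rw [hsum] at h1
  -- The clique number is only known to be at most `2 ^ k` and `p` need not be monotone, so `p` is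
  -- first replaced by its monotone majorant.
  refine (h1.trans_eq (hp _)).trans ((p.eval_le_mul_pow_natDegree (by exact_mod_cast hpos)).trans ?_)
  have hcast : ((G.cliqueNum : ℕ) : ℝ) ≤ 2 ^ k := by exact_mod_cast hle
  refine mul_le_mul_of_nonneg_left ?_ (Finset.sum_nonneg fun i _ => abs_nonneg _)
  rw [← pow_mul, mul_comm, pow_mul]
  exact pow_le_pow_left₀ (Nat.cast_nonneg _) hcast _

theorem theorem1p4 (t : ℕ) (ht : 1 ≤ t) (f : ℕ+ → ℕ+)
    (hf : IsChiBounding (BullFreeClass t) f)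
    (p : Polynomial ℝ) (hp : ∀ n : ℕ+, ((f n : ℕ) : ℝ) = p.eval ((n : ℕ) : ℝ))
    (hconst : t = 1 → 1 ≤ p.natDegree) :
    1 / 2 * Real.logb 2 (t : ℝ) < (p.natDegree : ℝ) := by
  rcases ht.eq_or_lt with rfl | ht2
  -- For `t = 1` the logarithm vanishes, and non-constancy is all that is needed.
  · simpa using Nat.lt_of_lt_of_le Nat.zero_lt_one (hconst rfl)
  obtain ⟨n, rfl⟩ : ∃ n, t = n + 1 := ⟨t - 1, by omega⟩
  obtain ⟨V, _, _, H, w, a, hH, hcol, hw, hsum, ha, hsq⟩ := exists_triangleFree_fractionalClique n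
  have hle := sum_fractionalClique_le_two_pow_natDegree ht hf hp hH hcol hw
  rw [hsum] at hle
  have hn : (1 : ℝ) ≤ n := by exact_mod_cast (show 1 ≤ n by omega)
  -- Strictness comes from `n + 1 < 2 * n + 1`, valid as `n ≥ 1`.
  have hlt : ((n + 1 : ℕ) : ℝ) < 2 ^ (2 * p.natDegree) := by
    have h2 : a ^ 2 ≤ (2 ^ p.natDegree) ^ 2 := pow_le_pow_left₀ ha hle 2
    rw [← pow_mul, mul_comm] at h2
    push_cast
    linarith
  have hlog : Real.logb 2 ((n + 1 : ℕ) : ℝ) < 2 * p.natDegree := by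
    rw [Real.logb_lt_iff_lt_rpow one_lt_two (by positivity)]
    exact_mod_cast hlt
  linarith
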